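/- Let $S$ and $A$ be finite sets of states and actions, $s_0\in S$ an initial state, $P:S\times A\times S\to[0,1]$ a transition function with $\sum_{s'\in S}P(s,a,s')=1$ for all $(s,a)\in S\times A$, and $\mathcal R:S\times A\times S\to\mathbb R$ a reward function. A policy $\pi$ maps each finite run $s_0a_0s_1\ldots s_n$ to a probability distribution over $A$, and it induces, together with $s_0$ and $P$, a probability measure $\mathbb P_\pi$, with expectation $\mathbb E_\pi$, on infinite runs $s_0a_0s_1a_1\ldots$. A policy is memoryless if the distribution depends only on the last state $s_n$ of the finite run, and deterministic if each of these distributions is a point mass. With $r_i=\mathcal R(s_i,a_i,s_{i+1})$ and $\gamma\in(0,1)$ put $$J_{\gamma}(\pi)=\mathbb E_\pi\Big[\sum_{i=0}^\infty\gamma^i r_i\Big],\qquad J_{\mathrm{avg}}(\pi)=\liminf_{t\to\infty}\mathbb E_\pi\Big[\frac1t\sum_{i=0}^{t-1}r_i\Big].$$ A policy is limit-average optimal if it maximises $J_{\mathrm{avg}}$ among all policies, including history-dependent and randomised ones. Let $\Pi$ be the (finite) set of memoryless deterministic policies. Suppose $(\gamma_k)_{k\in\mathbb N}$ is a nondecreasing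 sequence in $(0,1)$ with $\gamma_k\to1$, $(\epsilon_k)_{k\in\mathbb N}$ is a nonincreasing real sequence with $\epsilon_k\to0$, and each $\pi_k\in\Pi$ satisfies $J_{\gamma_k}(\pi_k)\ge J_{\gamma_k}(\pi)-\epsilon_k$ for all $\pi\in\Pi$. Then there exists $k_0$ such that for all $k\ge k_0$ the policy $\pi_k$ is limit-average optimal. -/

import Mathlib

open MeasureTheory ProbabilityTheory Filter Topology

/-- A Markov decision process with initial state `init` and transition probabilities
`P s a s'`; finiteness of `S` and `A` is assumed where the structure is used. -/
structure MDP (S A : Type*) where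
  init : S
  P : S → A → PMF S

/-- A finite run `s₀ a₀ s₁ a₁ … aₙ₋₁ sₙ`, stored as the list
`past = [(s₀, a₀), …, (sₙ₋₁, aₙ₋₁)]` and the last state `current = sₙ`. -/
structure FinRun (S A : Type*) where
  past : List (S × A)
  current : S

/-- A policy maps finite runs to distributions over actions (it may depend on the whole history
and it may randomise). -/
abbrev Policy (S A : Type*) := FinRun S A → PMF A

/-- A memoryless policy depends only on the last state of the finite run. -/
def Policy.IsMemoryless {S A : Type*} (π : Policy S A) : Prop :=
  ∀ ρ ρ' : FinRun S A, ρ.current = ρ'.current → π ρ = π ρ'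

/-- A deterministic policy always selects one action with probability one. -/
def Policy.IsDeterministic {S A : Type*} (π : Policy S A) : Prop :=
  ∀ ρ : FinRun S A, ∃ a : A, π ρ = PMF.pure a

/-- The infinite runs `s₀ a₀ s₁ a₁ …`; the `i`-th entry is `(sᵢ, aᵢ)`. -/
abbrev InfRun (S A : Type*) := ℕ → S × A

namespace MDP

noncomputable section

variable {S A : Type*}

/-- The law of `(s₀, a₀)`: the state is the initial state and the action is drawn from the
policy. -/
def initPMF (M : MDP S A) (π : Policy S A) : PMF (S × A) :=
  (π ⟨[], M.init⟩).map fun a => (M.init, a)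

/-- The law of `(sₙ₊₁, aₙ₊₁)` given `h = s₀ a₀ … sₙ aₙ`: draw `sₙ₊₁` from `P sₙ aₙ` and then
`aₙ₊₁` from `π (s₀ a₀ … sₙ aₙ sₙ₊₁)`. -/
def stepPMF (M : MDP S A) (π : Policy S A) (n : ℕ) (h : Finset.Iic n → S × A) : PMF (S × A) :=
  let last := h ⟨n, Finset.mem_Iic.2 le_rfl⟩
  (M.P last.1 last.2).bind fun s' =>
    (π ⟨List.ofFn fun i : Fin (n + 1) => h ⟨i, Finset.mem_Iic.2 (Nat.lt_succ_iff.1 i.2)⟩, s'⟩).map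
      fun a' => (s', a')

variable [Finite S] [Finite A] [MeasurableSpace S] [MeasurableSingletonClass S]
  [MeasurableSpace A] [MeasurableSingletonClass A]

/-- `stepPMF` as a Markov kernel. -/
def stepKernel (M : MDP S A) (π : Policy S A) (n : ℕ) :
    Kernel (Finset.Iic n → S × A) (S × A) :=
  Kernel.ofFunOfCountable fun h => (M.stepPMF π n h).toMeasure

instance (M : MDP S A) (π : Policy S A) (n : ℕ) : IsMarkovKernel (M.stepKernel π n) :=
  ⟨fun h => inferInstanceAs (IsProbabilityMeasure (M.stepPMF π n h).toMeasure)⟩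

/-- The probability measure on infinite runs induced by a policy (Ionescu-Tulcea). -/
def runMeasure (M : MDP S A) (π : Policy S A) : Measure (InfRun S A) :=
  Kernel.trajMeasure (X := fun _ => S × A) (M.initPMF π).toMeasure (M.stepKernel π)

/-- The reward `rᵢ = R sᵢ aᵢ sᵢ₊₁` collected at step `i` of a run. -/
def stepReward (R : S → A → S → ℝ) (ρ : InfRun S A) (i : ℕ) : ℝ :=
  R (ρ i).1 (ρ i).2 (ρ (i + 1)).1

/-- The `γ`-discounted-sum reward `𝔼[∑ γⁱ rᵢ]` of a policy. -/
def discountedReward (M : MDP S A) (R : S → A → S → ℝ) (γ : ℝ) (π : Policy S A) : ℝ :=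
  ∫ ρ, ∑' i : ℕ, γ ^ i * stepReward R ρ i ∂(M.runMeasure π)

/-- The limit-average reward `liminf_t 𝔼[(1/t) ∑_{i<t} rᵢ]` of a policy. -/
def limitAverageReward (M : MDP S A) (R : S → A → S → ℝ) (π : Policy S A) : ℝ :=
  liminf (fun t : ℕ =>
    ∫ ρ, (1 / (t : ℝ)) * ∑ i ∈ Finset.range t, stepReward R ρ i ∂(M.runMeasure π)) atTop

/-- `π` is limit-average optimal: no policy, even randomised or history-dependent, has a larger
limit-average reward. -/
def IsLimitAverageOptimal (M : MDP S A) (R : S → A → S → ℝ) (π : Policy S A) : Prop :=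
  ∀ π' : Policy S A, M.limitAverageReward R π' ≤ M.limitAverageReward R π

end

end MDP

/-! A policy in `Π` that is not limit-average optimal loses discounted reward of order `1 / (1 - γ)`
as `γ → 1`, so it cannot stay near-optimal. Let `g` be such a policy, beaten by some `π'`, and take
`c` strictly between their limit averages. Abel summation gives `J_γ(π') ≥ c / (1 - γ) - K` with `K`
independent of `γ` (`exists_div_sub_le_discountedReward`). Conversely `J_γ(g) ≤ J_avg(g) / (1 - γ) +
H` (`exists_discountedReward_ofFun_le`): a stochastic matrix does not increase the sup norm, so
rewards split into an invariant part and a telescoping coboundary.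

Since `π'` may use history and randomness, it is compared with `Π` through the Bellman equation,
which yields a policy in `Π` at least as good for the given `γ`
(`exists_ofFun_discountedReward_ge`). If `π_k = g`, then `(c - J_avg(g)) / (1 - γ_k) ≤ K + H + ε_k`,
which fails for large `k`. As `Π` is finite, one threshold serves every `g`. -/

/-! ### Orbit sums of norm-nonincreasing operators. -/

theorem LinearMap.norm_pow_apply_le {E : Type*} [NormedAddCommGroup E] [NormedSpace ℝ E]
    (T : E →ₗ[ℝ] E) (hT : ∀ v, ‖T v‖ ≤ ‖v‖) (n : ℕ) (v : E) : ‖(T ^ n) v‖ ≤ ‖v‖ := by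
  induction n with
  | zero => simp
  | succ n ih => rw [pow_succ', Module.End.mul_apply]; exact (hT _).trans ih

/-- A norm-nonincreasing endomorphism `T` of a finite-dimensional space splits the space into
fixed vectors and the range of `1 - T`. -/
theorem LinearMap.exists_fixed_add_coboundary {E : Type*} [NormedAddCommGroup E]
    [NormedSpace ℝ E] [FiniteDimensional ℝ E] (T : E →ₗ[ℝ] E) (hT : ∀ v, ‖T v‖ ≤ ‖v‖) (v : E) :
    ∃ g h : E, T g = g ∧ v = g + (h - T h) := by
  have hpow := T.norm_pow_apply_le hT
  -- A fixed vector `x = w - T w` satisfies `n x = w - T ^ n w`, which is bounded in `n`; hence `x =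
  -- 0`.
  have hdisj : Disjoint (LinearMap.range (1 - T)) (LinearMap.ker (1 - T)) := by
    rw [Submodule.disjoint_def]
    rintro _ ⟨w, rfl⟩ hx
    set x := (1 - T) w with hxdef
    have hTx : T x = x := by
      have : x - T x = 0 := by simpa using hx
      exact (sub_eq_zero.1 this).symm
    have hsum : ∀ n : ℕ, (n : ℝ) • x = w - (T ^ n) w := fun n => by
      induction n with
      | zero => simp
      | succ n ih =>
        have h1 : T ((n : ℝ) • x) = (n : ℝ) • x := by rw [map_smul, hTx]
        rw [ih, map_sub] at h1
        have h2 : x = w - T w := by simp [hxdef]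
        rw [pow_succ', Module.End.mul_apply, Nat.cast_succ, add_smul, one_smul, ih, h2, ← h1]
        abel
    have hbd : ∀ n : ℕ, (n : ℝ) * ‖x‖ ≤ 2 * ‖w‖ := fun n => by
      have h1 : ‖(n : ℝ) • x‖ = n * ‖x‖ := by rw [norm_smul, Real.norm_natCast]
      rw [← h1, hsum]
      linarith [norm_sub_le w ((T ^ n) w), hpow n w]
    by_contra hne
    obtain ⟨n, hn⟩ := exists_nat_gt (2 * ‖w‖ / ‖x‖)
    rw [div_lt_iff₀ (norm_pos_iff.2 hne)] at hn
    exact absurd (hbd n) (not_le.2 hn)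
  have htop := Submodule.eq_top_of_disjoint _ _
    (LinearMap.finrank_range_add_finrank_ker (1 - T)).ge hdisj
  obtain ⟨_, ⟨h, rfl⟩, g, hg, hv⟩ := Submodule.mem_sup.1 (htop ▸ Submodule.mem_top (x := v))
  refine ⟨g, h, ?_, ?_⟩
  · have : g - T g = 0 := by simpa using hg
    exact (sub_eq_zero.1 this).symm
  · rw [← hv]; simp [add_comm]

/-- The partial sums of an orbit of a norm-nonincreasing map grow linearly up to a bounded
error. -/
theorem LinearMap.exists_norm_sum_pow_sub_smul_le {E : Type*} [NormedAddCommGroup E]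
    [NormedSpace ℝ E] [FiniteDimensional ℝ E] (T : E →ₗ[ℝ] E) (hT : ∀ v, ‖T v‖ ≤ ‖v‖) (v : E) :
    ∃ (g : E) (K : ℝ), ∀ n : ℕ, ‖∑ i ∈ Finset.range n, (T ^ i) v - (n : ℝ) • g‖ ≤ K := by
  obtain ⟨g, h, hg, rfl⟩ := T.exists_fixed_add_coboundary hT v
  have hpow := T.norm_pow_apply_le hT
  have hgn : ∀ n : ℕ, (T ^ n) g = g := fun n => by
    induction n with
    | zero => simp
    | succ n ih => rw [pow_succ, Module.End.mul_apply, hg, ih]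
  refine ⟨g, 2 * ‖h‖, fun n => ?_⟩
  -- The coboundary part telescopes.
  have hs : ∑ i ∈ Finset.range n, (T ^ i) (g + (h - T h)) - (n : ℝ) • g = h - (T ^ n) h := by
    induction n with
    | zero => simp
    | succ n ih =>
      rw [sub_eq_iff_eq_add] at ih
      rw [Finset.sum_range_succ, ih, map_add, hgn, map_sub, pow_succ, Module.End.mul_apply,
        Nat.cast_succ, add_smul, one_smul]
      abel
  rw [hs]
  linarith [norm_sub_le h ((T ^ n) h), hpow n h]

/-! ### Discounted sums and averages of real sequences. -/

/-- Abel summation: a lower bound on the partial sums of `y` bounds its discounted partial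
sums. -/
theorem neg_le_sum_pow_mul_of_neg_le_sum {γ K : ℝ} (h0 : 0 ≤ γ) (h1 : γ ≤ 1) {y : ℕ → ℝ}
    (hy : ∀ n, -K ≤ ∑ i ∈ Finset.range n, y i) (n : ℕ) :
    -K ≤ ∑ i ∈ Finset.range n, γ ^ i * y i := by
  -- The extra term makes the induction close: lowering the weight from `γ ^ n` to `γ ^ (n + 1)`
  -- only decreases it, as the partial sum plus `K` is nonnegative.
  have key : γ ^ n * (∑ i ∈ Finset.range n, y i + K) - K ≤
      ∑ i ∈ Finset.range n, γ ^ i * y i := by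
    induction n with
    | zero => simp
    | succ n ih =>
      rw [Finset.sum_range_succ (fun i => γ ^ i * y i)]
      have h2 : γ ^ (n + 1) ≤ γ ^ n := pow_le_pow_of_le_one h0 h1 n.le_succ
      have h3 := mul_le_mul_of_nonneg_right h2
        (by linarith [hy (n + 1)] : 0 ≤ ∑ i ∈ Finset.range (n + 1), y i + K)
      rw [Finset.sum_range_succ] at h3 ⊢
      linarith
  have := mul_nonneg (pow_nonneg h0 n) (by linarith [hy n] : 0 ≤ ∑ i ∈ Finset.range n, y i + K)
  linarith

theorem summable_pow_mul_of_abs_le {γ C : ℝ} (hγ : γ ∈ Set.Ioo (0 : ℝ) 1) {m : ℕ → ℝ}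
    (hm : ∀ i, |m i| ≤ C) : Summable fun i => γ ^ i * m i := by
  refine Summable.of_norm_bounded
    ((summable_geometric_of_lt_one hγ.1.le hγ.2).mul_right C) fun i => ?_
  rw [norm_mul, norm_pow, Real.norm_of_nonneg hγ.1.le]
  exact mul_le_mul_of_nonneg_left (hm i) (pow_nonneg hγ.1.le i)

/-- If the partial sums of a bounded sequence `x` are at least `c n - K`, then its discounted sum
is at least `c / (1 - γ) - K`. -/
theorem div_sub_le_tsum_pow_mul {γ c K C : ℝ} (hγ : γ ∈ Set.Ioo (0 : ℝ) 1) {x : ℕ → ℝ}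
    (hC : ∀ i, |x i| ≤ C) (hx : ∀ n : ℕ, c * n - K ≤ ∑ i ∈ Finset.range n, x i) :
    c / (1 - γ) - K ≤ ∑' i, γ ^ i * x i := by
  have hs := summable_pow_mul_of_abs_le hγ hC
  have hg := (hasSum_geometric_of_lt_one hγ.1.le hγ.2).mul_right c
  have hd : HasSum (fun i => γ ^ i * (x i - c)) (∑' i, γ ^ i * x i - (1 - γ)⁻¹ * c) := by
    simpa only [mul_sub] using hs.hasSum.sub hg
  have hlow : -K ≤ ∑' i, γ ^ i * x i - (1 - γ)⁻¹ * c := by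
    refine ge_of_tendsto' hd.tendsto_sum_nat
      (neg_le_sum_pow_mul_of_neg_le_sum hγ.1.le hγ.2.le fun n => ?_)
    rw [Finset.sum_sub_distrib, Finset.sum_const, Finset.card_range, nsmul_eq_mul]
    linarith [hx n]
  rw [div_eq_inv_mul]
  linarith

/-- A lower bound on the inferior limit of the averages of a bounded sequence bounds all partial
sums linearly from below. -/
theorem exists_mul_sub_le_sum_of_lt_liminf {c C : ℝ} {x : ℕ → ℝ} (hC : ∀ i, |x i| ≤ C)
    (hc : c < liminf (fun t : ℕ => (1 / (t : ℝ)) * ∑ i ∈ Finset.range t, x i) atTop) :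
    ∃ K, ∀ n : ℕ, c * n - K ≤ ∑ i ∈ Finset.range n, x i := by
  have hsum : ∀ n : ℕ, |∑ i ∈ Finset.range n, x i| ≤ n * C := fun n =>
    (Finset.abs_sum_le_sum_abs _ _).trans <| by
      simpa using Finset.sum_le_sum fun i (_ : i ∈ Finset.range n) => hC i
  have hC0 : 0 ≤ C := (abs_nonneg _).trans (hC 0)
  have hbdd : IsBoundedUnder (· ≥ ·) atTop
      fun t : ℕ => (1 / (t : ℝ)) * ∑ i ∈ Finset.range t, x i := by
    refine isBoundedUnder_of ⟨-C, fun t => ?_⟩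
    rcases t.eq_zero_or_pos with rfl | ht
    · simpa using hC0
    · have ht' : (0 : ℝ) < t := Nat.cast_pos.2 ht
      rw [ge_iff_le, one_div, inv_mul_eq_div, le_div_iff₀ ht']
      linarith [neg_le_of_abs_le (hsum t)]
  obtain ⟨N, hN⟩ := eventually_atTop.1 (eventually_lt_of_lt_liminf hc hbdd)
  -- Only `n ≤ N` needs an error term; there `c * n` exceeds the partial sum by at most `(|c| + C) *
  -- n`.
  refine ⟨(|c| + C) * N, fun n => ?_⟩
  rcases le_or_gt n N with hn | hn
  · have h1 : (n : ℝ) ≤ N := Nat.cast_le.2 hn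
    have h2 := neg_le_of_abs_le (hsum n)
    have h3 : c * n ≤ |c| * n := mul_le_mul_of_nonneg_right (le_abs_self c) n.cast_nonneg
    have h4 := mul_le_mul_of_nonneg_left h1 (add_nonneg (abs_nonneg c) hC0)
    linarith
  · have hn' : (0 : ℝ) < n := Nat.cast_pos.2 (by lia)
    have h1 := hN n hn.le
    rw [one_div, inv_mul_eq_div, lt_div_iff₀ hn'] at h1
    have : 0 ≤ (|c| + C) * N := by positivity
    linarith

/-- If the partial sums of `x` are within bounded distance of `g n`, then its averages tend
to `g`. -/
theorem tendsto_average_of_abs_sum_sub_le {g K : ℝ} {x : ℕ → ℝ}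
    (hx : ∀ n : ℕ, |∑ i ∈ Finset.range n, x i - g * n| ≤ K) :
    Tendsto (fun t : ℕ => (1 / (t : ℝ)) * ∑ i ∈ Finset.range t, x i) atTop (𝓝 g) := by
  rw [tendsto_iff_dist_tendsto_zero]
  refine squeeze_zero' (Eventually.of_forall fun _ => dist_nonneg) ?_
    (tendsto_const_div_atTop_nhds_zero_nat K)
  filter_upwards [eventually_gt_atTop 0] with t ht
  have ht' : (0 : ℝ) < t := Nat.cast_pos.2 ht
  have : (1 / (t : ℝ)) * ∑ i ∈ Finset.range t, x i - g =
      (∑ i ∈ Finset.range t, x i - g * t) / t := by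
    field_simp
  rw [Real.dist_eq, this, abs_div, abs_of_pos ht']
  gcongr
  exact hx t

theorem abs_integral_le_of_abs_le {Ω : Type*} [MeasurableSpace Ω] (μ : Measure Ω)
    [IsProbabilityMeasure μ] {φ : Ω → ℝ} {C : ℝ} (h : ∀ x, |φ x| ≤ C) : |∫ x, φ x ∂μ| ≤ C := by
  simpa using norm_integral_le_of_norm_le_const (μ := μ) (f := φ) (Eventually.of_forall h)

/-! ### Memoryless deterministic policies as functions on states. -/

/-- The memoryless deterministic policy that plays `f s` in state `s`. -/
noncomputable def Policy.ofFun {S A : Type*} (f : S → A) : Policy S A :=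
  fun ρ => PMF.pure (f ρ.current)

theorem Policy.ofFun_isMemoryless {S A : Type*} (f : S → A) : (Policy.ofFun f).IsMemoryless :=
  fun _ _ h => by simp [Policy.ofFun, h]

theorem Policy.ofFun_isDeterministic {S A : Type*} (f : S → A) :
    (Policy.ofFun f).IsDeterministic :=
  fun _ => ⟨_, rfl⟩

theorem Policy.exists_eq_ofFun {S A : Type*} {π : Policy S A} (hm : π.IsMemoryless)
    (hd : π.IsDeterministic) : ∃ f : S → A, π = Policy.ofFun f := by
  choose g hg using hd
  refine ⟨fun s => g ⟨[], s⟩, funext fun ρ => ?_⟩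
  rw [hm ρ ⟨[], ρ.current⟩ rfl, hg]
  rfl

/-- Integration against the image of a probability mass function. -/
theorem PMF.integral_toMeasure_map {α β : Type*} [MeasurableSpace α] [MeasurableSpace β]
    [DiscreteMeasurableSpace α] [Finite β] [DiscreteMeasurableSpace β] (p : PMF α) (f : α → β)
    (φ : β → ℝ) : ∫ y, φ y ∂(p.map f).toMeasure = ∫ x, φ (f x) ∂p.toMeasure := by
  rw [← PMF.toMeasure_map (p := p) (f := f) Measurable.of_discrete,
    integral_map Measurable.of_discrete.aemeasurable
      (Measurable.of_discrete (f := φ)).aestronglyMeasurable]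

/-! ### One-step laws under the run measure. -/

namespace MDP

section

variable {S A : Type*}

theorem map_fst_stepPMF (M : MDP S A) (π : Policy S A) (n : ℕ) (h : Finset.Iic n → S × A) :
    (M.stepPMF π n h).map Prod.fst =
      M.P (h ⟨n, Finset.mem_Iic.2 le_rfl⟩).1 (h ⟨n, Finset.mem_Iic.2 le_rfl⟩).2 := by
  have hc : ∀ (s : S) (p : PMF A), p.map (fun _ => s) = PMF.pure s := fun s p => p.map_const s
  simp [stepPMF, PMF.map_bind, PMF.map_comp, Function.comp_def, hc]

theorem map_fst_initPMF (M : MDP S A) (π : Policy S A) :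
    (M.initPMF π).map Prod.fst = PMF.pure M.init := by
  rw [initPMF, PMF.map_comp]
  exact PMF.map_const _ _

theorem stepPMF_ofFun (M : MDP S A) (f : S → A) (n : ℕ) (h : Finset.Iic n → S × A) :
    M.stepPMF (Policy.ofFun f) n h =
      (M.P (h ⟨n, Finset.mem_Iic.2 le_rfl⟩).1 (h ⟨n, Finset.mem_Iic.2 le_rfl⟩).2).map
        fun s => (s, f s) := by
  simp [stepPMF, Policy.ofFun, PMF.map, Function.comp_def]

theorem initPMF_ofFun (M : MDP S A) (f : S → A) :
    M.initPMF (Policy.ofFun f) = PMF.pure (M.init, f M.init) := by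
  simp [initPMF, Policy.ofFun, PMF.pure_map]

end

variable {S A : Type*} [Finite S] [Finite A] [MeasurableSpace S] [MeasurableSingletonClass S]
  [MeasurableSpace A] [MeasurableSingletonClass A]

instance (M : MDP S A) (π : Policy S A) : IsProbabilityMeasure (M.runMeasure π) := by
  unfold runMeasure; infer_instance

/-- The Ionescu-Tulcea measure makes the joint law of the history up to `n` and the next entry a
composition-product. The integrand sees only the last entry of the history, while the kernel may
depend on all of it. -/
theorem integral_runMeasure_succ (M : MDP S A) (π : Policy S A) (n : ℕ)
    (φ : S × A → S × A → ℝ) :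
    ∫ ρ, φ (ρ n) (ρ (n + 1)) ∂M.runMeasure π =
      ∫ ρ, ∫ y, φ (ρ n) y ∂(M.stepPMF π n (Preorder.frestrictLe n ρ)).toMeasure
        ∂M.runMeasure π := by
  have key := Kernel.map_frestrictLe_trajMeasure_compProd_eq_map_trajMeasure
    (X := fun _ => S × A) (μ₀ := (M.initPMF π).toMeasure) (κ := M.stepKernel π) (a := n)
  let Φ : (Finset.Iic n → S × A) × (S × A) → ℝ :=
    fun z => φ (z.1 ⟨n, Finset.mem_Iic.2 le_rfl⟩) z.2
  have hΦ : Measurable Φ := Measurable.of_discrete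
  have hm : Measurable fun ρ : InfRun S A =>
      (Preorder.frestrictLe (π := fun _ => S × A) n ρ, ρ (n + 1)) := by
    fun_prop
  have hr : Measurable fun ρ : InfRun S A => Preorder.frestrictLe (π := fun _ => S × A) n ρ := by
    fun_prop
  have h1 : ∫ z, Φ z ∂((M.runMeasure π).map
      fun ρ => (Preorder.frestrictLe (π := fun _ => S × A) n ρ, ρ (n + 1))) =
      ∫ ρ, φ (ρ n) (ρ (n + 1)) ∂M.runMeasure π :=
    integral_map hm.aemeasurable hΦ.aestronglyMeasurable
  rw [← h1, runMeasure, ← key]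
  have : IsProbabilityMeasure ((Kernel.trajMeasure (X := fun _ => S × A) (M.initPMF π).toMeasure
      (M.stepKernel π)).map (Preorder.frestrictLe n)) :=
    Measure.isProbabilityMeasure_map hr.aemeasurable
  rw [Measure.integral_compProd Integrable.of_finite,
    integral_map hr.aemeasurable Measurable.of_discrete.aestronglyMeasurable]
  rfl

theorem map_eval_zero_runMeasure (M : MDP S A) (π : Policy S A) :
    (M.runMeasure π).map (fun ρ => ρ 0) = (M.initPMF π).toMeasure := by
  have hr : Measurable fun ρ : InfRun S A => Preorder.frestrictLe (π := fun _ => S × A) 0 ρ := by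
    fun_prop
  have h : (M.runMeasure π).map (Preorder.frestrictLe (π := fun _ => S × A) 0) =
      (M.initPMF π).toMeasure.map
        (MeasurableEquiv.piUnique (fun _ : Finset.Iic 0 => S × A)).symm := by
    rw [runMeasure, Kernel.trajMeasure, Measure.map_comp _ _ hr, Kernel.traj_map_frestrictLe,
      Kernel.partialTraj_self, Measure.id_comp]
  have h2 := congrArg (Measure.map fun z : Finset.Iic 0 → S × A => z default) h
  rw [Measure.map_map (by fun_prop) hr, Measure.map_map (by fun_prop) (by fun_prop)] at h2
  exact h2.trans Measure.map_id

theorem integral_state_zero (M : MDP S A) (π : Policy S A) (φ : S → ℝ) :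
    ∫ ρ, φ (ρ 0).1 ∂M.runMeasure π = φ M.init := by
  have h : ∫ x, φ x.1 ∂((M.runMeasure π).map fun ρ => ρ 0) = ∫ ρ, φ (ρ 0).1 ∂M.runMeasure π :=
    integral_map (measurable_pi_apply 0).aemeasurable Measurable.of_discrete.aestronglyMeasurable
  rw [← h, map_eval_zero_runMeasure, ← PMF.integral_toMeasure_map _ Prod.fst φ,
    map_fst_initPMF, PMF.toMeasure_pure, integral_dirac]

/-- Given the history and `aₙ`, the law of the next state does not involve the policy. This is why
Bellman estimates cover history-dependent policies. -/
theorem integral_transition (M : MDP S A) (π : Policy S A) (n : ℕ) (φ : S × A → S → ℝ) :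
    ∫ ρ, φ (ρ n) (ρ (n + 1)).1 ∂M.runMeasure π =
      ∫ ρ, ∫ s, φ (ρ n) s ∂(M.P (ρ n).1 (ρ n).2).toMeasure ∂M.runMeasure π := by
  rw [integral_runMeasure_succ M π n fun x y => φ x y.1]
  congr 1 with ρ
  rw [← PMF.integral_toMeasure_map _ Prod.fst (φ (ρ n)), map_fst_stepPMF]
  rfl

/-- Under a memoryless deterministic policy the action is a function of the state. -/
theorem integral_ofFun (M : MDP S A) (f : S → A) (n : ℕ) (φ : S × A → ℝ) :
    ∫ ρ, φ (ρ n) ∂M.runMeasure (Policy.ofFun f) =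
      ∫ ρ, φ ((ρ n).1, f (ρ n).1) ∂M.runMeasure (Policy.ofFun f) := by
  cases n with
  | zero =>
    have h : ∫ x, φ x ∂((M.runMeasure (Policy.ofFun f)).map fun ρ => ρ 0) =
        ∫ ρ, φ (ρ 0) ∂M.runMeasure (Policy.ofFun f) :=
      integral_map (measurable_pi_apply 0).aemeasurable
        Measurable.of_discrete.aestronglyMeasurable
    rw [integral_state_zero M (Policy.ofFun f) fun s => φ (s, f s), ← h,
      map_eval_zero_runMeasure, initPMF_ofFun, PMF.toMeasure_pure, integral_dirac]
  | succ n =>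
    rw [integral_runMeasure_succ M _ n fun _ y => φ y,
      integral_runMeasure_succ M _ n fun _ y => φ (y.1, f y.1)]
    congr 1 with ρ
    rw [stepPMF_ofFun, PMF.integral_toMeasure_map, PMF.integral_toMeasure_map]

theorem integrable_transition (M : MDP S A) (π : Policy S A) (n : ℕ)
    (φ : S × A → S × A → ℝ) :
    Integrable (fun ρ : InfRun S A => φ (ρ n) (ρ (n + 1))) (M.runMeasure π) := by
  have hm : Measurable fun ρ : InfRun S A => (ρ n, ρ (n + 1)) := by fun_prop
  have : IsProbabilityMeasure ((M.runMeasure π).map fun ρ => (ρ n, ρ (n + 1))) :=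
    Measure.isProbabilityMeasure_map hm.aemeasurable
  exact (Integrable.of_finite (f := fun z : (S × A) × (S × A) => φ z.1 z.2)).comp_measurable hm

end MDP

/-- A bounded supersolution `X` of the discounted recursion dominates the discounted sum. -/
theorem tsum_pow_mul_le_of_add_mul_le {γ C B : ℝ} (hγ : γ ∈ Set.Ioo (0 : ℝ) 1) {m X : ℕ → ℝ}
    (hm : ∀ i, |m i| ≤ C) (hX : ∀ i, |X i| ≤ B) (h : ∀ i, m i + γ * X (i + 1) ≤ X i) :
    ∑' i, γ ^ i * m i ≤ X 0 := by
  -- The recursion unrolled `n` times; the remainder `γ ^ n * X n` vanishes in the limit.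
  have hsum : ∀ n, ∑ i ∈ Finset.range n, γ ^ i * m i + γ ^ n * X n ≤ X 0 := fun n => by
    induction n with
    | zero => simp
    | succ n ih =>
      rw [Finset.sum_range_succ, pow_succ]
      have := mul_le_mul_of_nonneg_left (h n) (pow_nonneg hγ.1.le n)
      linarith
  have hlim : Tendsto (fun n => γ ^ n * X n) atTop (𝓝 0) :=
    (summable_pow_mul_of_abs_le hγ hX).tendsto_atTop_zero
  have h2 := (summable_pow_mul_of_abs_le hγ hm).hasSum.tendsto_sum_nat.add hlim
  rw [add_zero] at h2
  exact le_of_tendsto' h2 hsum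

/-! ### Expected rewards and the induced Markov chain. -/

namespace MDP

theorem exists_abs_reward_le {S A : Type*} [Finite S] [Finite A] (R : S → A → S → ℝ) :
    ∃ C, ∀ s a s', |R s a s'| ≤ C := by
  obtain ⟨C, hC⟩ := (Set.finite_range fun z : S × A × S => |R z.1 z.2.1 z.2.2|).bddAbove
  exact ⟨C, fun s a s' => hC ⟨(s, a, s'), rfl⟩⟩

variable {S A : Type*} [Finite S] [Finite A] [MeasurableSpace S] [MeasurableSingletonClass S]
  [MeasurableSpace A] [MeasurableSingletonClass A]

theorem integrable_stepReward (M : MDP S A) (R : S → A → S → ℝ) (π : Policy S A) (i : ℕ) :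
    Integrable (fun ρ => stepReward R ρ i) (M.runMeasure π) :=
  M.integrable_transition π i fun x y => R x.1 x.2 y.1

/-- The expected reward at step `i`. -/
noncomputable def meanReward (M : MDP S A) (R : S → A → S → ℝ) (π : Policy S A) (i : ℕ) : ℝ :=
  ∫ ρ, stepReward R ρ i ∂M.runMeasure π

theorem exists_abs_meanReward_le (M : MDP S A) (R : S → A → S → ℝ) :
    ∃ C, ∀ π i, |M.meanReward R π i| ≤ C := by
  obtain ⟨C, hC⟩ := exists_abs_reward_le R
  exact ⟨C, fun π i => abs_integral_le_of_abs_le _ fun ρ => hC _ _ _⟩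

/-- Both criteria become functionals of the one real sequence `meanReward`, so that the Abelian
estimates apply. -/
theorem discountedReward_eq_tsum (M : MDP S A) (R : S → A → S → ℝ) {γ : ℝ}
    (hγ : γ ∈ Set.Ioo (0 : ℝ) 1) (π : Policy S A) :
    M.discountedReward R γ π = ∑' i, γ ^ i * M.meanReward R π i := by
  obtain ⟨C, hC⟩ := exists_abs_reward_le R
  rw [discountedReward, ← integral_tsum_of_summable_integral_norm
    (fun i => (M.integrable_stepReward R π i).const_mul (γ ^ i))]
  · simp_rw [integral_const_mul]; rfl
  · refine Summable.of_norm_bounded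
      ((summable_geometric_of_lt_one hγ.1.le hγ.2).mul_right C) fun i => ?_
    refine abs_integral_le_of_abs_le _ fun ρ => ?_
    rw [abs_norm, norm_mul, norm_pow, Real.norm_of_nonneg hγ.1.le]
    exact mul_le_mul_of_nonneg_left (hC _ _ _) (pow_nonneg hγ.1.le i)

theorem limitAverageReward_eq_liminf (M : MDP S A) (R : S → A → S → ℝ) (π : Policy S A) :
    M.limitAverageReward R π =
      liminf (fun t : ℕ => (1 / (t : ℝ)) * ∑ i ∈ Finset.range t, M.meanReward R π i) atTop := by
  unfold limitAverageReward meanReward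
  congr 1 with t
  rw [integral_const_mul, integral_finsetSum _ fun i _ => M.integrable_stepReward R π i]

/-- The transition operator of the Markov chain induced by the memoryless deterministic policy
`f`, acting on functions of the state. -/
noncomputable def transitionMap (M : MDP S A) (f : S → A) : (S → ℝ) →ₗ[ℝ] (S → ℝ) where
  toFun v s := ∫ s', v s' ∂(M.P s (f s)).toMeasure
  map_add' _ _ := funext fun _ => integral_add Integrable.of_finite Integrable.of_finite
  map_smul' c _ := funext fun _ => integral_const_mul c _

theorem norm_transitionMap_le [Fintype S] (M : MDP S A) (f : S → A) (v : S → ℝ) :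
    ‖M.transitionMap f v‖ ≤ ‖v‖ :=
  (pi_norm_le_iff_of_nonneg (norm_nonneg v)).2 fun _ =>
    abs_integral_le_of_abs_le _ fun s' => norm_le_pi_norm v s'

theorem integral_state_ofFun (M : MDP S A) (f : S → A) (n : ℕ) (v : S → ℝ) :
    ∫ ρ, v (ρ n).1 ∂M.runMeasure (Policy.ofFun f) = (M.transitionMap f ^ n) v M.init := by
  -- The last transition is absorbed into `v`, so the hypothesis is needed at `M.transitionMap f v`.
  induction n generalizing v with
  | zero => exact M.integral_state_zero _ v
  | succ n ih =>
    rw [M.integral_transition _ n fun _ => v,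
      M.integral_ofFun f n fun x => ∫ s, v s ∂(M.P x.1 x.2).toMeasure, pow_succ,
      Module.End.mul_apply]
    exact ih (M.transitionMap f v)

theorem meanReward_ofFun (M : MDP S A) (R : S → A → S → ℝ) (f : S → A) (n : ℕ) :
    M.meanReward R (Policy.ofFun f) n = (M.transitionMap f ^ n)
      (fun s => ∫ s', R s (f s) s' ∂(M.P s (f s)).toMeasure) M.init := by
  rw [← integral_state_ofFun, meanReward]
  unfold stepReward
  rw [M.integral_transition _ n fun x s => R x.1 x.2 s]
  exact M.integral_ofFun f n fun x => ∫ s, R x.1 x.2 s ∂(M.P x.1 x.2).toMeasure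

/-- The expected total reward of a memoryless deterministic policy grows linearly up to a bounded
error. -/
theorem exists_abs_sum_meanReward_sub_le (M : MDP S A) (R : S → A → S → ℝ) (f : S → A) :
    ∃ g K : ℝ, ∀ n : ℕ,
      |∑ i ∈ Finset.range n, M.meanReward R (Policy.ofFun f) i - g * n| ≤ K := by
  have := Fintype.ofFinite S
  obtain ⟨g, K, hK⟩ := (M.transitionMap f).exists_norm_sum_pow_sub_smul_le
    (M.norm_transitionMap_le f) fun s => ∫ s', R s (f s) s' ∂(M.P s (f s)).toMeasure
  refine ⟨g M.init, K, fun n => ?_⟩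
  have h := (norm_le_pi_norm _ M.init).trans (hK n)
  simp only [meanReward_ofFun]
  rw [Pi.sub_apply, Finset.sum_apply, Pi.smul_apply, smul_eq_mul, mul_comm] at h
  exact h

/-! ### The discounted Bellman equation. -/

/-- The expected immediate reward plus the discounted value of the next state. -/
noncomputable def actionValue (M : MDP S A) (R : S → A → S → ℝ) (γ : ℝ) (V : S → ℝ) (x : S × A) :
    ℝ :=
  ∫ s', (R x.1 x.2 s' + γ * V s') ∂(M.P x.1 x.2).toMeasure

theorem meanReward_add_mul (M : MDP S A) (R : S → A → S → ℝ) (γ : ℝ) (V : S → ℝ)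
    (π : Policy S A) (n : ℕ) :
    M.meanReward R π n + γ * ∫ ρ, V (ρ (n + 1)).1 ∂M.runMeasure π =
      ∫ ρ, M.actionValue R γ V (ρ n) ∂M.runMeasure π := by
  unfold actionValue
  rw [← M.integral_transition π n fun x s' => R x.1 x.2 s' + γ * V s', meanReward,
    ← integral_const_mul, ← integral_add (M.integrable_stepReward R π n)
      ((M.integrable_transition π n fun _ y => V y.1).const_mul γ)]
  rfl

/-- Whatever the policy, the expectations of `V` at the successive states form a bounded
supersolution of the discounted recursion. -/
theorem discountedReward_le_of_actionValue_le (M : MDP S A) (R : S → A → S → ℝ) {γ : ℝ}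
    (hγ : γ ∈ Set.Ioo (0 : ℝ) 1) {V : S → ℝ} (hV : ∀ x, M.actionValue R γ V x ≤ V x.1)
    (π : Policy S A) : M.discountedReward R γ π ≤ V M.init := by
  have := Fintype.ofFinite S
  obtain ⟨C, hC⟩ := M.exists_abs_meanReward_le R
  rw [M.discountedReward_eq_tsum R hγ, ← M.integral_state_zero π V]
  refine tsum_pow_mul_le_of_add_mul_le hγ (hC π) (B := ‖V‖)
    (X := fun n => ∫ ρ, V (ρ n).1 ∂M.runMeasure π)
    (fun i => abs_integral_le_of_abs_le _ fun ρ => norm_le_pi_norm V _) fun n => ?_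
  rw [meanReward_add_mul]
  exact integral_mono (M.integrable_transition π n fun x _ => M.actionValue R γ V x)
    (M.integrable_transition π n fun x _ => V x.1) fun ρ => hV (ρ n)

theorem le_discountedReward_ofFun_of_actionValue_eq (M : MDP S A) (R : S → A → S → ℝ) {γ : ℝ}
    (hγ : γ ∈ Set.Ioo (0 : ℝ) 1) {V : S → ℝ} {f : S → A}
    (hV : ∀ s, M.actionValue R γ V (s, f s) = V s) :
    V M.init ≤ M.discountedReward R γ (Policy.ofFun f) := by
  have := Fintype.ofFinite S
  obtain ⟨C, hC⟩ := M.exists_abs_meanReward_le R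
  -- Negation turns the lower bound into the supersolution estimate.
  rw [M.discountedReward_eq_tsum R hγ, ← M.integral_state_zero (Policy.ofFun f) V, ← neg_le_neg_iff,
    ← tsum_neg]
  simp_rw [← mul_neg]
  refine tsum_pow_mul_le_of_add_mul_le hγ (C := C) (fun i => by rw [abs_neg]; exact hC _ i)
    (B := ‖V‖) (X := fun n => -∫ ρ, V (ρ n).1 ∂M.runMeasure (Policy.ofFun f))
    (fun i => by
      rw [abs_neg]; exact abs_integral_le_of_abs_le _ fun ρ => norm_le_pi_norm V _) fun n => ?_
  rw [mul_neg, ← neg_add, meanReward_add_mul, integral_ofFun]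
  simp_rw [hV]
  exact le_rfl

theorem abs_actionValue_sub_le [Fintype S] (M : MDP S A) (R : S → A → S → ℝ) {γ : ℝ}
    (hγ : 0 ≤ γ) (V W : S → ℝ) (x : S × A) :
    |M.actionValue R γ V x - M.actionValue R γ W x| ≤ γ * dist V W := by
  rw [actionValue, actionValue, ← integral_sub Integrable.of_finite Integrable.of_finite]
  refine abs_integral_le_of_abs_le _ fun s' => ?_
  rw [add_sub_add_left_eq_sub, ← mul_sub, abs_mul, abs_of_nonneg hγ]
  exact mul_le_mul_of_nonneg_left (dist_le_pi_dist V W s') hγ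

/-- The discounted optimality equation has a solution. -/
theorem exists_bellman_solution [Nonempty A] (M : MDP S A) (R : S → A → S → ℝ) {γ : ℝ}
    (hγ : γ ∈ Set.Ioo (0 : ℝ) 1) : ∃ V : S → ℝ, ∀ s, V s = ⨆ a, M.actionValue R γ V (s, a) := by
  have := Fintype.ofFinite S
  let B : (S → ℝ) → S → ℝ := fun V s => ⨆ a, M.actionValue R γ V (s, a)
  have hle : ∀ V W s, B V s ≤ B W s + γ * dist V W := fun V W s =>
    ciSup_le fun a => by
      have h1 := le_abs_self (M.actionValue R γ V (s, a) - M.actionValue R γ W (s, a))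
      have h2 := M.abs_actionValue_sub_le R hγ.1.le V W (s, a)
      have h3 : M.actionValue R γ W (s, a) ≤ B W s :=
        le_ciSup (f := fun a => M.actionValue R γ W (s, a)) (Set.finite_range _).bddAbove a
      linarith
  -- The Bellman operator is a `γ`-contraction in the sup norm, so Banach's theorem supplies the
  -- fixed point.
  have hB : ContractingWith ⟨γ, hγ.1.le⟩ B := by
    refine ⟨hγ.2, LipschitzWith.of_dist_le_mul fun V W => ?_⟩
    refine (dist_pi_le_iff (mul_nonneg hγ.1.le dist_nonneg)).2 fun s => ?_
    have h1 := hle V W s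
    have h2 := hle W V s
    rw [dist_comm W V] at h2
    exact abs_sub_le_iff.2 ⟨sub_le_iff_le_add'.2 h1, sub_le_iff_le_add'.2 h2⟩
  exact ⟨hB.fixedPoint, fun s => (congrFun hB.fixedPoint_isFixedPt s).symm⟩

/-- Some memoryless deterministic policy is optimal for the discounted reward among all
policies. -/
theorem exists_ofFun_discountedReward_ge [Nonempty A] (M : MDP S A) (R : S → A → S → ℝ) {γ : ℝ}
    (hγ : γ ∈ Set.Ioo (0 : ℝ) 1) : ∃ f : S → A, ∀ π : Policy S A,
      M.discountedReward R γ π ≤ M.discountedReward R γ (Policy.ofFun f) := by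
  obtain ⟨V, hV⟩ := M.exists_bellman_solution R hγ
  choose f hf using fun s => exists_eq_ciSup_of_finite (f := fun a => M.actionValue R γ V (s, a))
  refine ⟨f, fun π => (M.discountedReward_le_of_actionValue_le R hγ (fun x => ?_) π).trans
    (M.le_discountedReward_ofFun_of_actionValue_eq R hγ fun s => (hf s).trans (hV s).symm)⟩
  rw [hV]
  exact le_ciSup (f := fun a => M.actionValue R γ V (x.1, a)) (Set.finite_range _).bddAbove x.2

/-! ### Discounted reward as `γ → 1`, and the conclusion. -/

theorem exists_div_sub_le_discountedReward (M : MDP S A) (R : S → A → S → ℝ) {π : Policy S A}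
    {c : ℝ} (hc : c < M.limitAverageReward R π) :
    ∃ K, ∀ γ ∈ Set.Ioo (0 : ℝ) 1, c / (1 - γ) - K ≤ M.discountedReward R γ π := by
  obtain ⟨C, hC⟩ := M.exists_abs_meanReward_le R
  rw [limitAverageReward_eq_liminf] at hc
  obtain ⟨K, hK⟩ := exists_mul_sub_le_sum_of_lt_liminf (hC π) hc
  refine ⟨K, fun γ hγ => ?_⟩
  rw [M.discountedReward_eq_tsum R hγ]
  exact div_sub_le_tsum_pow_mul hγ (hC π) hK

/-- For a finite chain the averages converge, with bounded error in the partial sums, so the limit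
average itself is the coefficient of `1 / (1 - γ)`. -/
theorem exists_discountedReward_ofFun_le (M : MDP S A) (R : S → A → S → ℝ) (f : S → A) :
    ∃ K, ∀ γ ∈ Set.Ioo (0 : ℝ) 1, M.discountedReward R γ (Policy.ofFun f) ≤
      M.limitAverageReward R (Policy.ofFun f) / (1 - γ) + K := by
  obtain ⟨C, hC⟩ := M.exists_abs_meanReward_le R
  obtain ⟨g, K, hK⟩ := M.exists_abs_sum_meanReward_sub_le R f
  have hg : M.limitAverageReward R (Policy.ofFun f) = g := by
    rw [limitAverageReward_eq_liminf]
    exact (tendsto_average_of_abs_sum_sub_le hK).liminf_eq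
  refine ⟨K, fun γ hγ => ?_⟩
  -- The upper bound is the lower bound for the negated rewards.
  have h := div_sub_le_tsum_pow_mul (c := -g) (K := K) hγ
    (x := fun i => -M.meanReward R (Policy.ofFun f) i)
    (fun i => (abs_neg _).trans_le (hC _ i)) fun n => by
      rw [Finset.sum_neg_distrib]
      linarith [le_of_abs_le (hK n)]
  simp_rw [mul_neg] at h
  rw [tsum_neg, neg_div] at h
  rw [M.discountedReward_eq_tsum R hγ, hg]
  linarith

end MDP

theorem mainTheorem7 {S A : Type*} [Finite S] [Finite A]
    [MeasurableSpace S] [MeasurableSingletonClass S]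
    [MeasurableSpace A] [MeasurableSingletonClass A]
    (M : MDP S A) (R : S → A → S → ℝ)
    (γ ε : ℕ → ℝ) (π : ℕ → Policy S A)
    (hγ : ∀ k, γ k ∈ Set.Ioo (0 : ℝ) 1) (hγ_mono : Monotone γ) (hγ_lim : Tendsto γ atTop (𝓝 1))
    (hε_anti : Antitone ε) (hε_lim : Tendsto ε atTop (𝓝 0))
    (hπ : ∀ k, (π k).IsMemoryless ∧ (π k).IsDeterministic)
    (hopt : ∀ k, ∀ π' : Policy S A, π'.IsMemoryless → π'.IsDeterministic →
      M.discountedReward R (γ k) π' - ε k ≤ M.discountedReward R (γ k) (π k)) :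
    ∃ k₀ : ℕ, ∀ k ≥ k₀, M.IsLimitAverageOptimal R (π k) := by
  choose f hf using fun k => Policy.exists_eq_ofFun (hπ k).1 (hπ k).2
  have : Nonempty A := ⟨f 0 M.init⟩
  -- Fixing the value `g` of `f k` lets finiteness of `S → A` merge the separate thresholds.
  suffices h : ∀ᶠ k in atTop, ∀ g : S → A, f k = g →
      M.IsLimitAverageOptimal R (Policy.ofFun g) by
    obtain ⟨k₀, hk₀⟩ := eventually_atTop.1 h
    exact ⟨k₀, fun k hk => hf k ▸ hk₀ k hk (f k) rfl⟩
  refine eventually_all.2 fun g => ?_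
  by_cases hg : M.IsLimitAverageOptimal R (Policy.ofFun g)
  · exact Eventually.of_forall fun _ _ => hg
  simp only [MDP.IsLimitAverageOptimal, not_forall, not_le] at hg
  obtain ⟨π', hπ'⟩ := hg
  -- The lower bound for `π'` is available only for slopes strictly below its inferior limit.
  obtain ⟨c, hgc, hc⟩ := exists_between hπ'
  obtain ⟨K, hK⟩ := M.exists_div_sub_le_discountedReward R hc
  obtain ⟨H, hH⟩ := M.exists_discountedReward_ofFun_le R g
  have hlim : Tendsto (fun k => (1 - γ k) * (K + H + ε k)) atTop (𝓝 0) := by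
    simpa using (hγ_lim.const_sub 1).mul (hε_lim.const_add (K + H))
  filter_upwards [hlim.eventually_lt_const (sub_pos.2 hgc)] with k hk hfk
  exfalso
  have hpos : 0 < 1 - γ k := sub_pos.2 (hγ k).2
  -- `hopt` says nothing about a general `π'`; `f'` dominates it at the discount `γ k`.
  obtain ⟨f', hf'⟩ := M.exists_ofFun_discountedReward_ge R (hγ k)
  have h1 := hopt k _ (Policy.ofFun_isMemoryless f') (Policy.ofFun_isDeterministic f')
  rw [hf k, hfk] at h1
  have h2 : (c - M.limitAverageReward R (Policy.ofFun g)) / (1 - γ k) ≤ K + H + ε k := by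
    rw [sub_div]
    linarith [hK _ (hγ k), hH _ (hγ k), hf' π']
  rw [div_le_iff₀ hpos] at h2
  linarith
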